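/- Write $\|X\|$ for the area of a set $X\subseteq\mathbb{R}^2$. A homothetic copy of a set $P\subseteq\mathbb{R}^2$ is a set $rP+t$ with $r>0$ and $t\in\mathbb{R}^2$. For $\alpha\in[0,1]$, a member $S_v$ of a collection $\{S_v\}_{v\in V}$ of homothetic copies of $P$ is called $\alpha$-free if $\bigl\|S_v\setminus\bigcup_{u\in V\setminus\{v\}}S_u\bigr\|\ \ge\ \alpha\,\|S_v\|$. There is an $\alpha\in[0,1)$ such that, for every integer $n>6$, every (filled) regular $n$-gon $P_n$ and every three homothetic copies $S_u,S_v,S_w$ of $P_n$ that have a common point $p\in S_u\cap S_v\cap S_w$, one of the three copies is not $\alpha$-free in the collection $\{S_u,S_v,S_w\}$. -/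

import Mathlib

open MeasureTheory

/-- The Euclidean plane, with its Euclidean norm and Lebesgue measure (area). -/
abbrev Plane : Type := EuclideanSpace ℝ (Fin 2)

/-- The (filled) regular `n`-gon with center `c`, circumradius `R` and one corner in direction `θ`:
the convex hull of `n` points equally spaced on a circle. -/
noncomputable def regularNGon (n : ℕ) (c : Plane) (R θ : ℝ) : Set Plane :=
  convexHull ℝ (Set.range fun k : Fin n =>
    c + R • (!₂[Real.cos (θ + 2 * Real.pi * (k : ℝ) / (n : ℝ)),
      Real.sin (θ + 2 * Real.pi * (k : ℝ) / (n : ℝ))] : Plane))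

/-- `P` is a (filled, nondegenerate) regular `n`-gon in the plane, of any position, size and
rotation. -/
def IsRegularNGon (n : ℕ) (P : Set Plane) : Prop :=
  3 ≤ n ∧ ∃ (c : Plane) (R θ : ℝ), 0 < R ∧ P = regularNGon n c R θ

/-- `T` is a homothetic copy of `P`: it is obtained from `P` by positive scaling and
translation. -/
def IsHomotheticCopy (P T : Set Plane) : Prop :=
  ∃ (r : ℝ) (t : Plane), 0 < r ∧ T = (fun x => r • x + t) '' P

/-- The member `S v` of the collection `S` is `α`-free: at least an `α`-fraction of its area is
not covered by the other members. -/
def IsFreeMember {V : Type*} (α : ℝ) (S : V → Set Plane) (v : V) : Prop :=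
  ENNReal.ofReal α * volume (S v) ≤ volume (S v \ ⋃ (u : V) (_ : u ≠ v), S u)

/-! For `n > 6`, `cos (π / n) ≥ 0.89 > √3 / 2`, so each copy is round in the sense of `IsRound`. Two
of the three directions from `p` to the centers enclose at most 120°, so their bisector `e` is
within 60° of both. A ray at such an angle passes within `√3 / 2 * R` of the center, hence well
inside the inner disk; convexity shrinks a disk found there towards `p`
(`IsRound.closedBall_subset`). Scaled to the smaller copy, one disk lies in both copies and covers a
fixed fraction of the smaller. -/

/-- A convex set lying between two concentric disks of radii `89/100 * R` and `R`. -/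
structure IsRound (c : Plane) (R : ℝ) (S : Set Plane) : Prop where
  pos : 0 < R
  convex : Convex ℝ S
  inner_subset : Metric.closedBall c (89 / 100 * R) ⊆ S
  subset_outer : S ⊆ Metric.closedBall c R

lemma IsRound.homothety {c : Plane} {R : ℝ} {S : Set Plane} (h : IsRound c R S)
    {r : ℝ} (hr : 0 < r) (t : Plane) :
    IsRound (r • c + t) (r * R) ((fun x => r • x + t) '' S) := by
  refine ⟨mul_pos hr h.pos, ?_, ?_, ?_⟩
  · simpa only [add_comm] using h.convex.affinity t r
  · intro x hx
    refine ⟨r⁻¹ • (x - t), h.inner_subset ?_, ?_⟩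
    · rw [mem_closedBall_iff_norm] at hx ⊢
      have e : r⁻¹ • (x - t) - c = r⁻¹ • (x - (r • c + t)) := by
        rw [← sub_sub, sub_right_comm, smul_sub r⁻¹ (x - t), inv_smul_smul₀ hr.ne']
      rw [e, norm_smul, Real.norm_of_nonneg (inv_pos.2 hr).le, inv_mul_le_iff₀ hr]
      linarith
    · simp [smul_inv_smul₀ hr.ne']
  · rintro _ ⟨x, hx, rfl⟩
    have := h.subset_outer hx
    rw [mem_closedBall_iff_norm] at this ⊢
    have e : r • x + t - (r • c + t) = r • (x - c) := by rw [smul_sub]; abel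
    simp only [e, norm_smul, Real.norm_of_nonneg hr.le]
    gcongr

lemma exists_polar (u : Plane) :
    ∃ ψ : ℝ, u 0 = ‖u‖ * Real.cos ψ ∧ u 1 = ‖u‖ * Real.sin ψ := by
  have hn : ‖u‖ = ‖(⟨u 0, u 1⟩ : ℂ)‖ := by
    rw [EuclideanSpace.norm_eq, Complex.norm_eq_sqrt_sq_add_sq]
    simp [Fin.sum_univ_two]
  refine ⟨Complex.arg ⟨u 0, u 1⟩, ?_, ?_⟩
  · rw [hn, Complex.norm_mul_cos_arg]
  · rw [hn, Complex.norm_mul_sin_arg]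

/-- Every direction makes an angle of at most `π / n` with one of `n` equally spaced directions. -/
lemma exists_cos_pi_div_le {n : ℕ} (hn : 0 < n) (φ : ℝ) :
    ∃ k : Fin n, Real.cos (Real.pi / n) ≤ Real.cos (φ - 2 * Real.pi * (k : ℝ) / n) := by
  have hn' : (0 : ℝ) < n := by exact_mod_cast hn
  have hπ := Real.pi_pos
  set τ : ℝ := φ * n / (2 * Real.pi) with hτ
  set m : ℤ := round τ with hm
  have hnz : (n : ℤ) ≠ 0 := by exact_mod_cast hn.ne'
  have h0 : 0 ≤ m % n := Int.emod_nonneg _ hnz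
  have h1 : m % n < n := Int.emod_lt_of_pos _ (by exact_mod_cast hn)
  refine ⟨⟨(m % n).toNat, by omega⟩, ?_⟩
  have hk : (((m % n).toNat : ℕ) : ℝ) = m - n * (m / n : ℤ) := by
    have e1 : (((m % n).toNat : ℕ) : ℤ) = m - n * (m / n) := by
      rw [Int.toNat_of_nonneg h0]
      exact Int.emod_def _ _
    exact_mod_cast e1
  have e : φ - 2 * Real.pi * (((m % n).toNat : ℕ) : ℝ) / n
      = (2 * Real.pi / n * (τ - m)) + (m / n : ℤ) * (2 * Real.pi) := by
    rw [hk, hτ]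
    field_simp
    ring
  simp only [e, Real.cos_add_int_mul_two_pi]
  rw [← Real.cos_abs (2 * Real.pi / n * (τ - m))]
  apply Real.cos_le_cos_of_nonneg_of_le_pi (abs_nonneg _)
  · exact div_le_self hπ.le (by exact_mod_cast hn)
  · rw [abs_mul, abs_of_pos (by positivity)]
    calc 2 * Real.pi / n * |τ - m| ≤ 2 * Real.pi / n * (1 / 2) := by
          gcongr
          exact abs_sub_round τ
      _ = Real.pi / n := by ring

lemma le_cos_pi_div {n : ℕ} (hn : 6 < n) : 89 / 100 ≤ Real.cos (Real.pi / n) := by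
  have hn' : (7 : ℝ) ≤ n := by exact_mod_cast hn
  have h1 : Real.pi / n ≤ 3.15 / 7 :=
    div_le_div₀ (by norm_num) Real.pi_lt_d2.le (by norm_num) hn'
  have h0 : 0 ≤ Real.pi / n := by positivity
  have h2 := Real.one_sub_sq_div_two_le_cos (x := Real.pi / n)
  nlinarith

/-- A functional separating a point from the polygon is nearly maximal on the disk at the vertex
closest to its direction, so that point cannot lie in the inner disk. -/
lemma isRound_regularNGon {n : ℕ} (hn : 6 < n) (c : Plane) {R : ℝ} (hR : 0 < R) (θ : ℝ) :
    IsRound c R (regularNGon n c R θ) := by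
  refine ⟨hR, convex_convexHull ℝ _, ?_, ?_⟩
  · intro x hx
    by_contra hxS
    have hclosed : IsClosed (regularNGon n c R θ) :=
      (Set.finite_range _).isClosed_convexHull ℝ
    obtain ⟨f, b, hfb, hbx⟩ := geometric_hahn_banach_closed_point
      (convex_convexHull ℝ _) hclosed hxS
    set u : Plane := (InnerProductSpace.toDual ℝ Plane).symm f with hu
    have hf : ∀ y, f y = inner ℝ u y := fun y => by
      rw [hu, InnerProductSpace.toDual_symm_apply]
    obtain ⟨ψ, h0, h1⟩ := exists_polar u
    obtain ⟨k, hk⟩ := exists_cos_pi_div_le (by omega : 0 < n) (ψ - θ)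
    set e : Plane := !₂[Real.cos (θ + 2 * Real.pi * (k : ℝ) / (n : ℝ)),
      Real.sin (θ + 2 * Real.pi * (k : ℝ) / (n : ℝ))] with he
    have hv := hfb (c + R • e) (subset_convexHull ℝ _ ⟨k, rfl⟩)
    have hue : inner ℝ u e = ‖u‖ * Real.cos (ψ - θ - 2 * Real.pi * (k : ℝ) / n) := by
      rw [PiLp.inner_apply, Fin.sum_univ_two, h0, h1, sub_sub, Real.cos_sub, he]
      simp
      ring
    have hxc : f (x - c) ≤ ‖u‖ * (89 / 100 * R) := by
      rw [hf]
      refine (real_inner_le_norm _ _).trans ?_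
      gcongr
      exact mem_closedBall_iff_norm.1 hx
    rw [map_add, map_smul, smul_eq_mul, hf e, hue] at hv
    rw [map_sub] at hxc
    have := mul_le_mul_of_nonneg_left ((le_cos_pi_div hn).trans hk)
      (mul_nonneg hR.le (norm_nonneg u))
    nlinarith
  · refine convexHull_min ?_ (convex_closedBall c R)
    rintro _ ⟨k, rfl⟩
    rw [mem_closedBall_iff_norm, add_sub_cancel_left, norm_smul, Real.norm_of_nonneg hR.le,
      EuclideanSpace.norm_eq]
    simp [Fin.sum_univ_two]

/-- If the direction `e` makes an angle of at most `π / 3` with the direction from `p` to the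
center, then `S` contains a disk of comparable size in direction `e` from `p`. -/
lemma IsRound.closedBall_subset {c : Plane} {R : ℝ} {S : Set Plane} (h : IsRound c R S)
    {p : Plane} (hp : p ∈ S) {e : Plane} (he : ‖e‖ = 1)
    (hec : ‖c - p‖ / 2 ≤ inner ℝ e (c - p)) {m : ℝ} (hm : 0 < m) (hmR : m ≤ R) :
    Metric.closedBall (p + (m / 4) • e) (m / 200) ⊆ S := by
  have hR := h.pos
  have hw : ‖c - p‖ ≤ R := by
    rw [← dist_eq_norm, dist_comm]
    exact h.subset_outer hp
  set w := c - p with hwdef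
  -- a scaling factor carrying a concentric part of the disk to the required one
  obtain ⟨s, hs, hms, hsw⟩ : ∃ s : ℝ, 0 < s ∧ m ≤ 4 * s ∧ s ≤ R ∧
      ‖s • e - w‖ + s / 50 ≤ 89 / 100 * R := by
    have key : ∀ s : ℝ, ‖s • e - w‖ ^ 2 = s ^ 2 - 2 * s * inner ℝ e w + ‖w‖ ^ 2 := by
      intro s
      rw [norm_sub_sq_real, norm_smul, he, real_inner_smul_left, mul_one, Real.norm_eq_abs,
        sq_abs]
      ring
    have hle : inner ℝ e w ≤ ‖w‖ := by simpa [he] using real_inner_le_norm e w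
    rcases le_or_gt (R / 2) ‖w‖ with h2 | h2
    -- The foot of the perpendicular from the center to the ray; `867 / 1000` is just above `√3 /
    -- 2`.
    · refine ⟨inner ℝ e w, by linarith, by linarith, by linarith, ?_⟩
      have : ‖(inner ℝ e w : ℝ) • e - w‖ ≤ 867 / 1000 * R := by
        refine abs_le_of_sq_le_sq' ?_ (by positivity) |>.2
        rw [key]
        nlinarith [norm_nonneg w]
      linarith
    -- Here `p` is so close to the center that any direction works.
    · refine ⟨R / 4, by linarith, by linarith, by linarith, ?_⟩
      have : ‖(R / 4) • e - w‖ ≤ R / 4 + ‖w‖ := by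
        refine (norm_sub_le _ _).trans ?_
        rw [norm_smul, he, Real.norm_of_nonneg (by positivity), mul_one]
      linarith
  intro x hx
  rw [mem_closedBall_iff_norm] at hx
  set t : ℝ := m / (4 * s) with ht
  have ht0 : 0 < t := by positivity
  have ht1 : t ≤ 1 := by rw [ht, div_le_one (by positivity)]; exact hms
  have hts : t * s = m / 4 := by rw [ht]; field_simp
  have hq : p + t⁻¹ • (x - p) ∈ S := by
    apply h.inner_subset
    rw [mem_closedBall_iff_norm]
    have e1 : p + t⁻¹ • (x - p) - c = (s • e - w) + t⁻¹ • (x - (p + (m / 4) • e)) := by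
      have : t⁻¹ • ((m / 4) • e) = s • e := by
        rw [smul_smul, ← hts, inv_mul_cancel_left₀ ht0.ne']
      rw [← sub_sub x, smul_sub t⁻¹ (x - p), this, hwdef]
      abel
    rw [e1]
    refine (norm_add_le _ _).trans (le_trans ?_ hsw.2)
    gcongr
    rw [norm_smul, Real.norm_of_nonneg (inv_pos.2 ht0).le, inv_mul_le_iff₀ ht0]
    linarith
  have := h.convex.add_smul_sub_mem hp hq ⟨ht0.le, ht1⟩
  simpa [smul_inv_smul₀ ht0.ne'] using this

lemma exists_unit_direction (w : Plane) : ∃ d : Plane, ‖d‖ = 1 ∧ w = ‖w‖ • d := by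
  rcases eq_or_ne w 0 with rfl | hw
  · exact ⟨EuclideanSpace.single 0 1, by simp, by simp⟩
  · refine ⟨‖w‖⁻¹ • w, norm_smul_inv_norm hw, ?_⟩
    rw [smul_inv_smul₀ (norm_ne_zero_iff.2 hw)]

/-- Two of three unit vectors enclose an angle of at most `2 * π / 3`. -/
lemma exists_neg_half_le_inner (d : Fin 3 → Plane) (hd : ∀ i, ‖d i‖ = 1) :
    ∃ i j, i ≠ j ∧ -(1 / 2) ≤ inner ℝ (d i) (d j) := by
  by_contra! H
  have h01 := H 0 1 (by decide)
  have h02 := H 0 2 (by decide)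
  have h12 := H 1 2 (by decide)
  -- Three inner products below `-1/2` would make this square negative.
  have h := sq_nonneg ‖d 0 + d 1 + d 2‖
  rw [norm_add_sq_real, norm_add_sq_real, inner_add_left, hd, hd, hd] at h
  linarith

lemma exists_common_direction {d d' : Plane} (hd : ‖d‖ = 1) (hd' : ‖d'‖ = 1)
    (h : -(1 / 2) ≤ inner ℝ d d') :
    ∃ e : Plane, ‖e‖ = 1 ∧ 1 / 2 ≤ inner ℝ e d ∧ 1 / 2 ≤ inner ℝ e d' := by
  have hsq : ‖d + d'‖ ^ 2 = 2 + 2 * inner ℝ d d' := by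
    rw [norm_add_sq_real, hd, hd']
    ring
  have h1 : 1 ≤ ‖d + d'‖ := by nlinarith [norm_nonneg (d + d')]
  have hpos : 0 < ‖d + d'‖ := by linarith
  have hdd : inner ℝ d d = (1 : ℝ) := by rw [real_inner_self_eq_norm_sq, hd]; norm_num
  have hdd' : inner ℝ d' d' = (1 : ℝ) := by rw [real_inner_self_eq_norm_sq, hd']; norm_num
  refine ⟨‖d + d'‖⁻¹ • (d + d'), norm_smul_inv_norm (norm_pos_iff.1 hpos), ?_, ?_⟩
  · rw [real_inner_smul_left, le_inv_mul_iff₀ hpos, inner_add_left, hdd, real_inner_comm]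
    nlinarith
  · rw [real_inner_smul_left, le_inv_mul_iff₀ hpos, inner_add_left, hdd']
    nlinarith

/-- The shared disk has `1 / 40000` of the outer disk's area, so at least that share of `S i`;
halving it makes the inequality strict. -/
lemma IsRound.not_isFreeMember {V : Type*} {S : V → Set Plane} {i j : V} (hij : j ≠ i)
    {c : Plane} {R : ℝ} (h : IsRound c R (S i)) {q : Plane}
    (hi : Metric.closedBall q (R / 200) ⊆ S i) (hj : Metric.closedBall q (R / 200) ⊆ S j) :
    ¬ IsFreeMember (1 - 1 / 80000) S i := by
  set B := Metric.closedBall q (R / 200) with hB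
  set U := Metric.closedBall c R with hU
  have hR := h.pos
  have hUfin : volume U ≠ ⊤ := measure_closedBall_lt_top.ne
  have hBfin : volume B ≠ ⊤ := measure_closedBall_lt_top.ne
  have hSU : volume (S i) ≤ volume U := measure_mono h.subset_outer
  have hSfin : volume (S i) ≠ ⊤ := ne_top_of_le_ne_top hUfin hSU
  have hUpos : 0 < (volume U).toReal :=
    ENNReal.toReal_pos (Metric.measure_closedBall_pos _ _ hR).ne' hUfin
  have hBU : (volume B).toReal = (volume U).toReal / 40000 := by
    rw [hB, hU, Measure.addHaar_closedBall _ _ (by positivity),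
      Measure.addHaar_closedBall _ _ hR.le, ENNReal.toReal_mul, ENNReal.toReal_mul,
      ENNReal.toReal_ofReal (by positivity), ENNReal.toReal_ofReal (by positivity)]
    simp
    ring
  have hle : volume (S i \ ⋃ (u : V) (_ : u ≠ i), S u) ≤ volume (S i) - volume B := by
    rw [← measure_sdiff hi Metric.isClosed_closedBall.measurableSet.nullMeasurableSet hBfin]
    refine measure_mono (Set.sdiff_subset_sdiff_right (hj.trans ?_))
    exact Set.subset_biUnion_of_mem (u := S) (s := {u | u ≠ i}) hij
  intro hfree
  have hfree' := ENNReal.toReal_mono (ENNReal.sub_ne_top hSfin) (hfree.trans hle)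
  rw [ENNReal.toReal_mul, ENNReal.toReal_ofReal (by norm_num),
    ENNReal.toReal_sub_of_le (measure_mono hi) hSfin] at hfree'
  have := ENNReal.toReal_mono hUfin hSU
  linarith

theorem mainTheorem6 :
    ∃ α : ℝ, 0 ≤ α ∧ α < 1 ∧
      ∀ n : ℕ, 6 < n →
        ∀ P : Set Plane, IsRegularNGon n P →
          ∀ S : Fin 3 → Set Plane, (∀ i, IsHomotheticCopy P (S i)) →
            ∀ p : Plane, (∀ i, p ∈ S i) →
              ∃ i, ¬ IsFreeMember α S i := by
  refine ⟨1 - 1 / 80000, by norm_num, by norm_num, ?_⟩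
  rintro n hn P ⟨-, c₀, R₀, θ, hR₀, rfl⟩ S hS p hp
  have hround : ∀ i, ∃ c R, IsRound c R (S i) := fun i => by
    obtain ⟨r, t, hr, h⟩ := hS i
    exact ⟨_, _, h ▸ (isRound_regularNGon hn c₀ hR₀ θ).homothety hr t⟩
  choose c R hR using hround
  choose d hd hdc using fun i => exists_unit_direction (c i - p)
  have half_le : ∀ {i e}, 1 / 2 ≤ inner ℝ e (d i) → ‖c i - p‖ / 2 ≤ inner ℝ e (c i - p) := by
    intro i e h
    rw [hdc i, real_inner_smul_right, ← hdc i]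
    nlinarith [norm_nonneg (c i - p)]
  have key : ∀ i j, i ≠ j → -(1 / 2) ≤ inner ℝ (d i) (d j) → R i ≤ R j →
      ¬ IsFreeMember (1 - 1 / 80000) S i := by
    intro i j hij h hle
    obtain ⟨e, he, hei, hej⟩ := exists_common_direction (hd i) (hd j) h
    exact (hR i).not_isFreeMember hij.symm
      ((hR i).closedBall_subset (hp i) he (half_le hei) (hR i).pos le_rfl)
      ((hR j).closedBall_subset (hp j) he (half_le hej) (hR i).pos hle)
  obtain ⟨i, j, hij, h⟩ := exists_neg_half_le_inner d hd
  rcases le_total (R i) (R j) with hle | hle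
  · exact ⟨i, key i j hij h hle⟩
  · exact ⟨j, key j i hij.symm (by rwa [real_inner_comm]) hle⟩
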